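/- Let $m,n,p$ be nonnegative integers, $H\in\mathbb{R}^{m\times p}$, $S_0\in\mathbb{R}^{p\times n}$, $L_0\in\mathbb{R}^{m\times n}$, and $M_0=HS_0+L_0$. Let $H=U_H\Sigma_HV_H^\top$ be a compact singular value decomposition: with $r=\operatorname{rank}(H)$, the matrices $U_H\in\mathbb{R}^{m\times r}$ and $V_H\in\mathbb{R}^{p\times r}$ have orthonormal columns and $\Sigma_H\in\mathbb{R}^{r\times r}$ is diagonal with positive diagonal entries. Put $C=U_H\Sigma_H^{-1}U_H^\top$ and $\tilde H=CH$ $(=U_HV_H^\top)$. For a matrix $X$ write $\|X\|_1=\sum_{i,j}|x_{ij}|$, $\|X\|_\infty=\max_{i,j}|x_{ij}|$, $\|X\|$ for its spectral norm and $\|X\|_*$ for its nuclear norm (the sum of its singular values). Let $\Omega(S_0)$ be the set of all $A\in\mathbb{R}^{p\times n}$ whose support is contained in the support of $S_0$. Let $\mathcal{T}(L)$ be the tangent space at $L$ to the variety of all $m\times n$ real matrices of rank at most $\operatorname{rank}(L)$. Let $P_{\ker H}$ be the orthogonal projection of $\mathbb{R}^p$ onto $\ker H$, acting on the columns of a matrix.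 For $G\in\mathbb{R}^{m\times p}$ put $$\mu_G(S)=\max_{A\in\Omega(S),\ \|A\|_\infty\le 1}\|GA\|,\qquad \xi_G(L)=\max_{B\in\mathcal{T}(L),\ \|B\|\le 1}\|G^\top B\|_\infty .$$ Suppose that there is a real number $\delta<1/3$ such that $$\|P_{\ker H}A\|_\infty\le\delta\|A\|_\infty\quad\text{for all }A\in\Omega(S_0),\qquad\text{and}\qquad \mu_{\tilde H}(S_0)\,\xi_{\tilde H}(CL_0)<\frac{1-3\delta}{6}.$$ Then there exists $\gamma>0$ such that for every optimizer $(\hat S_c,\hat Y)$ of $$\min_{S\in\mathbb{R}^{p\times n},\,Y\in\mathbb{R}^{m\times n}}\ \gamma\|S\|_1+\|Y\|_*\quad\text{subject to}\quad Y+\tilde HS=CM_0,$$ the matrices $\hat S_c$ and $\hat L_c:=M_0-H\hat S_c$ satisfy $\hat S_c=S_0$ and $\hat L_c=L_0$. -/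

import Mathlib

namespace MatSep

noncomputable section

/-- The vectorised `ℓ₁` norm: the sum of the absolute values of the entries. -/
def l1Norm {p n : ℕ} (X : Matrix (Fin p) (Fin n) ℝ) : ℝ :=
  ∑ i, ∑ j, |X i j|

/-- The vectorised infinity norm: the largest absolute value of an entry (`0` if there is none). -/
def maxNorm {p n : ℕ} (X : Matrix (Fin p) (Fin n) ℝ) : ℝ :=
  ⨆ ij : Fin p × Fin n, |X ij.1 ij.2|

/-- The spectral norm: the operator norm with respect to the Euclidean norms. -/
def spectralNorm {m n : ℕ} (X : Matrix (Fin m) (Fin n) ℝ) : ℝ :=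
  ‖LinearMap.toContinuousLinearMap (Matrix.toEuclideanLin X)‖

/-- The nuclear norm: the sum of the first `rank X` (that is, of the nonzero) singular values. -/
def nuclearNorm {m n : ℕ} (X : Matrix (Fin m) (Fin n) ℝ) : ℝ :=
  ∑ i ∈ Finset.range X.rank, (Matrix.toEuclideanLin X).singularValues i

/-- `H = U Σ Vᵀ` is a compact singular value decomposition, with `Σ = diag σ`. -/
structure IsCompactSVD {m p : ℕ} (H : Matrix (Fin m) (Fin p) ℝ)
    (U : Matrix (Fin m) (Fin H.rank) ℝ) (σ : Fin H.rank → ℝ)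
    (V : Matrix (Fin p) (Fin H.rank) ℝ) : Prop where
  orthonormal_left : U.transpose * U = 1
  orthonormal_right : V.transpose * V = 1
  pos : ∀ i, 0 < σ i
  eq_mul : H = U * Matrix.diagonal σ * V.transpose

/-- `Ω(S)`: the matrices whose support lies within the support of `S`. -/
def Omega {p n : ℕ} (S : Matrix (Fin p) (Fin n) ℝ) : Set (Matrix (Fin p) (Fin n) ℝ) :=
  {A | ∀ i j, S i j = 0 → A i j = 0}

/-- The tangent space at `L` to the variety of the matrices of rank at most `rank L`: all
velocities at `L` of curves in that variety (of which `L` is a smooth point). -/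
def tangentSpace {m n : ℕ} (L : Matrix (Fin m) (Fin n) ℝ) : Set (Matrix (Fin m) (Fin n) ℝ) :=
  {B | ∃ c : ℝ → Matrix (Fin m) (Fin n) ℝ, c 0 = L ∧ (∀ t, (c t).rank ≤ L.rank) ∧
    ∀ i j, HasDerivAt (fun t => c t i j) (B i j) 0}

/-- `P_{ker H} A`: the orthogonal projection onto `ker H ⊆ ℝᵖ`, applied to each column of `A`. -/
def projKer {m p n : ℕ} (H : Matrix (Fin m) (Fin p) ℝ) (A : Matrix (Fin p) (Fin n) ℝ) :
    Matrix (Fin p) (Fin n) ℝ :=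
  Matrix.of fun i j =>
    (LinearMap.ker (Matrix.toEuclideanLin H)).starProjection (WithLp.toLp 2 fun k => A k j) i

/-- `μ_H(S) = max {‖H A‖ : A ∈ Ω(S), ‖A‖_∞ ≤ 1}`. -/
def mu {m p n : ℕ} (H : Matrix (Fin m) (Fin p) ℝ) (S : Matrix (Fin p) (Fin n) ℝ) : ℝ :=
  sSup {x | ∃ A ∈ Omega S, maxNorm A ≤ 1 ∧ x = spectralNorm (H * A)}

/-- `ξ_H(L) = max {‖Hᵀ B‖_∞ : B ∈ 𝒯(L), ‖B‖ ≤ 1}`. -/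
def xi {m p n : ℕ} (H : Matrix (Fin m) (Fin p) ℝ) (L : Matrix (Fin m) (Fin n) ℝ) : ℝ :=
  sSup {x | ∃ B ∈ tangentSpace L, spectralNorm B ≤ 1 ∧ x = maxNorm (H.transpose * B)}

/-- `(S, Y)` minimises `γ ‖S‖₁ + ‖Y‖_*` subject to `Y + H S = M`. -/
def IsOptimizer {m p n : ℕ} (γ : ℝ) (H : Matrix (Fin m) (Fin p) ℝ)
    (M : Matrix (Fin m) (Fin n) ℝ) (S : Matrix (Fin p) (Fin n) ℝ)
    (Y : Matrix (Fin m) (Fin n) ℝ) : Prop :=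
  Y + H * S = M ∧
    ∀ (S' : Matrix (Fin p) (Fin n) ℝ) (Y' : Matrix (Fin m) (Fin n) ℝ), Y' + H * S' = M →
      γ * l1Norm S + nuclearNorm Y ≤ γ * l1Norm S' + nuclearNorm Y'

end

end MatSep

/-! Put `W = H̃` and `Y = C L₀`. The proof constructs a dual certificate `Q = E + N(W A)`: here `E`
is the polar factor of `Y`, `N` (`normalPart`) projects onto the orthogonal complement of the
tangent space at `Y`, and `A ∈ Ω(S₀)`. Such a `Q` is a subgradient of the nuclear norm at `Y` once
`‖N(W A)‖ ≤ 1`, and `Wᵀ Q` is a subgradient of `γ‖·‖₁` at `S₀` once it equals `γ sign S₀` on the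
support and is at most `γ` in absolute value off it.

Since `Wᵀ W = V Vᵀ = 1 - P_{ker H}`, on `Ω(S₀)` the matrix `A - Wᵀ N(W A)` is the sum of `P_{ker H}
A` and `Wᵀ` times the tangential part of `W A`, so its max norm is at most `c‖A‖_∞` with `c = δ +
2μξ < 1` (`abs_sub_transpose_mul_normalPart_le`). Hence the equation on the support is solvable
(`exists_certificate`), and the bound on `μξ` leaves room for a `γ` making both dual inequalities
strict (`exists_tradeoff`).

Strictness forces an optimizer `S₀ + D` to satisfy `D ∈ Ω(S₀)` and `N(W D) = 0`; the same estimate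
then gives `‖D‖_∞ ≤ c‖D‖_∞`, so `D = 0` (`exists_forall_isOptimizer_eq`). The equality `L̂_c = L₀`
follows from `M₀ = H S₀ + L₀`. -/

namespace MatSep

open Matrix
open scoped Matrix.Norms.L2Operator

/-! ### Spectral norm: contractions and entry bounds. -/

section SpectralNorm

variable {m n k : ℕ}

theorem spectralNorm_eq_norm (X : Matrix (Fin m) (Fin n) ℝ) : spectralNorm X = ‖X‖ := rfl

theorem norm_toLp_sq (x : Fin n → ℝ) : ‖WithLp.toLp 2 x‖ ^ 2 = x ⬝ᵥ x := by
  rw [EuclideanSpace.real_norm_sq_eq]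
  simp [dotProduct, sq]

theorem dotProduct_mulVec_self_le (X : Matrix (Fin m) (Fin n) ℝ) (x : Fin n → ℝ) :
    (X *ᵥ x) ⬝ᵥ (X *ᵥ x) ≤ ‖X‖ ^ 2 * (x ⬝ᵥ x) := by
  rw [← norm_toLp_sq, ← norm_toLp_sq, ← mul_pow]
  exact pow_le_pow_left₀ (norm_nonneg _) (l2_opNorm_mulVec X (WithLp.toLp 2 x)) 2

theorem norm_le_one_of_dotProduct_le (X : Matrix (Fin m) (Fin n) ℝ)
    (h : ∀ x : Fin n → ℝ, (X *ᵥ x) ⬝ᵥ (X *ᵥ x) ≤ x ⬝ᵥ x) : ‖X‖ ≤ 1 := by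
  rw [l2_opNorm_def]
  refine ContinuousLinearMap.opNorm_le_bound _ zero_le_one fun x => ?_
  have := h x.ofLp
  rw [← norm_toLp_sq, ← norm_toLp_sq] at this
  rw [one_mul]
  exact le_of_sq_le_sq this (norm_nonneg _)

theorem abs_apply_le_norm (X : Matrix (Fin m) (Fin n) ℝ) (i : Fin m) (j : Fin n) :
    |X i j| ≤ ‖X‖ := by
  refine abs_le_of_sq_le_sq ?_ (norm_nonneg _)
  have h := dotProduct_mulVec_self_le X (Pi.single j 1)
  rw [mulVec_single_one] at h
  simp only [dotProduct_single, Pi.single_eq_same, mul_one] at h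
  refine le_trans ?_ h
  simp only [dotProduct, col_apply, ← sq]
  exact Finset.single_le_sum (f := fun i => X i j ^ 2) (fun _ _ => sq_nonneg _) (Finset.mem_univ i)

theorem norm_transpose (X : Matrix (Fin m) (Fin n) ℝ) : ‖Xᵀ‖ = ‖X‖ := by
  rw [← conjTranspose_eq_transpose_of_trivial, l2_opNorm_conjTranspose]

theorem norm_transpose_mul_self (X : Matrix (Fin m) (Fin n) ℝ) : ‖Xᵀ * X‖ = ‖X‖ * ‖X‖ := by
  rw [← conjTranspose_eq_transpose_of_trivial, l2_opNorm_conjTranspose_mul_self]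

theorem norm_le_one_of_symm_idem {P : Matrix (Fin n) (Fin n) ℝ} (hs : Pᵀ = P) (hi : P * P = P) :
    ‖P‖ ≤ 1 := by
  have h := norm_transpose_mul_self P
  rw [hs, hi] at h
  nlinarith [norm_nonneg P]

theorem norm_le_one_of_transpose_mul_self {X : Matrix (Fin m) (Fin n) ℝ}
    (h : ‖Xᵀ * X‖ ≤ 1) : ‖X‖ ≤ 1 := by
  rw [norm_transpose_mul_self] at h
  nlinarith [norm_nonneg X]

theorem norm_mul_le_of_left {A : Matrix (Fin m) (Fin n) ℝ} (hA : ‖A‖ ≤ 1)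
    (B : Matrix (Fin n) (Fin k) ℝ) : ‖A * B‖ ≤ ‖B‖ :=
  (l2_opNorm_mul A B).trans (mul_le_of_le_one_left (norm_nonneg _) hA)

theorem norm_mul_le_of_right (A : Matrix (Fin m) (Fin n) ℝ)
    {B : Matrix (Fin n) (Fin k) ℝ} (hB : ‖B‖ ≤ 1) : ‖A * B‖ ≤ ‖A‖ :=
  (l2_opNorm_mul A B).trans (mul_le_of_le_one_right (norm_nonneg _) hB)

end SpectralNorm

/-! ### Entrywise maximum norm. -/

section MaxNorm

variable {p n : ℕ}

theorem abs_apply_le_maxNorm (X : Matrix (Fin p) (Fin n) ℝ) (i : Fin p) (j : Fin n) :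
    |X i j| ≤ maxNorm X :=
  le_ciSup (f := fun ij : Fin p × Fin n => |X ij.1 ij.2|) (Set.finite_range _).bddAbove (i, j)

theorem maxNorm_nonneg (X : Matrix (Fin p) (Fin n) ℝ) : 0 ≤ maxNorm X :=
  Real.iSup_nonneg fun _ => abs_nonneg _

theorem maxNorm_le {X : Matrix (Fin p) (Fin n) ℝ} {c : ℝ} (hc : 0 ≤ c)
    (h : ∀ i j, |X i j| ≤ c) : maxNorm X ≤ c :=
  Real.iSup_le (fun ij => h ij.1 ij.2) hc

theorem maxNorm_smul (c : ℝ) (X : Matrix (Fin p) (Fin n) ℝ) :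
    maxNorm (c • X) = |c| * maxNorm X := by
  simp [maxNorm, abs_mul, Real.mul_iSup_of_nonneg]

theorem eq_zero_of_maxNorm_le {X : Matrix (Fin p) (Fin n) ℝ} (h : maxNorm X ≤ 0) : X = 0 := by
  ext i j
  simpa using (abs_apply_le_maxNorm X i j).trans h

/-- A crude bound whose only role is to show that the set defining `mu` is bounded above, so that
its `sSup` is meaningful. -/
theorem norm_mul_le_sum {m : ℕ} (G : Matrix (Fin m) (Fin p) ℝ) (A : Matrix (Fin p) (Fin n) ℝ) :
    ‖G * A‖ ≤ (∑ i : Fin p, ∑ j : Fin n, ‖G * single i j (1 : ℝ)‖) * maxNorm A := by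
  conv_lhs => rw [matrix_eq_sum_single A]
  simp only [Matrix.mul_sum, Finset.sum_mul]
  refine (norm_sum_le _ _).trans (Finset.sum_le_sum fun i _ => ?_)
  refine (norm_sum_le _ _).trans (Finset.sum_le_sum fun j _ => ?_)
  have : single i j (A i j) = A i j • single i j (1 : ℝ) := by simp
  rw [this, Matrix.mul_smul, norm_smul, mul_comm]
  exact mul_le_mul_of_nonneg_left (abs_apply_le_maxNorm A i j) (norm_nonneg _)

end MaxNorm

/-! ### The estimates supplied by `mu` and `xi`. -/

section Incoherence

variable {m n p : ℕ}

theorem mu_nonneg (G : Matrix (Fin m) (Fin p) ℝ) (S : Matrix (Fin p) (Fin n) ℝ) : 0 ≤ mu G S := by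
  refine Real.sSup_nonneg ?_
  rintro _ ⟨A, -, -, rfl⟩
  exact norm_nonneg _

theorem xi_nonneg (G : Matrix (Fin m) (Fin p) ℝ) (L : Matrix (Fin m) (Fin n) ℝ) : 0 ≤ xi G L := by
  refine Real.sSup_nonneg ?_
  rintro _ ⟨A, -, -, rfl⟩
  exact maxNorm_nonneg _

theorem norm_mul_le_mu (G : Matrix (Fin m) (Fin p) ℝ) {S A : Matrix (Fin p) (Fin n) ℝ}
    (hA : A ∈ Omega S) : ‖G * A‖ ≤ mu G S * maxNorm A := by
  rcases (maxNorm_nonneg A).eq_or_lt with h | h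
  · rw [eq_zero_of_maxNorm_le h.ge]
    simpa using mul_nonneg (mu_nonneg G S) (maxNorm_nonneg _)
  · rw [← div_le_iff₀ h]
    refine le_csSup ⟨∑ i : Fin p, ∑ j : Fin n, ‖G * single i j (1 : ℝ)‖, ?_⟩
      ⟨(maxNorm A)⁻¹ • A, fun i j hij => by simp [hA i j hij], ?_, ?_⟩
    · rintro _ ⟨B, -, hB, rfl⟩
      refine (norm_mul_le_sum G B).trans (mul_le_of_le_one_right ?_ hB)
      positivity
    · rw [maxNorm_smul, abs_of_pos (inv_pos.2 h), inv_mul_cancel₀ h.ne']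
    · rw [spectralNorm_eq_norm, Matrix.mul_smul, norm_smul, Real.norm_of_nonneg (inv_pos.2 h).le,
        div_eq_inv_mul]

/-- The curve `(1 + tK) L (1 + tN)` never exceeds the rank of `L` and has this velocity at `0`. Only
this inclusion into the tangent space is ever needed. -/
theorem mul_add_mul_mem_tangentSpace (L : Matrix (Fin m) (Fin n) ℝ)
    (N : Matrix (Fin n) (Fin n) ℝ) (K : Matrix (Fin m) (Fin m) ℝ) :
    L * N + K * L ∈ tangentSpace L := by
  refine ⟨fun t => (1 + t • K) * L * (1 + t • N), by simp, fun t => ?_, fun i j => ?_⟩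
  · exact (rank_mul_le_left _ _).trans (rank_mul_le_right _ _)
  · have h : (fun t : ℝ => ((1 + t • K) * L * (1 + t • N) : Matrix (Fin m) (Fin n) ℝ) i j)
        = fun t => L i j + t * (L * N + K * L) i j + t ^ 2 * (K * L * N) i j := by
      ext t
      have : (1 + t • K) * L * (1 + t • N) = L + t • (L * N + K * L) + t ^ 2 • (K * L * N) := by
        simp only [Matrix.add_mul, Matrix.mul_add, Matrix.one_mul, Matrix.mul_one,
          Matrix.smul_mul, Matrix.mul_smul, smul_add, smul_smul, sq]
        abel
      simp [this, mul_add]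
    rw [h]
    have h1 := ((hasDerivAt_id (0 : ℝ)).mul_const ((L * N + K * L) i j)).const_add (L i j)
    have h2 := ((hasDerivAt_id (0 : ℝ)).pow 2).mul_const ((K * L * N) i j)
    exact (h1.add h2).congr_deriv (by simp)

/-- Homogeneity of `xi`. With `B` given as `L N + K L`, normalising `B` amounts to rescaling `N` and
`K`, so membership in the tangent space is preserved. -/
theorem maxNorm_transpose_mul_le_xi (G : Matrix (Fin m) (Fin p) ℝ)
    (L : Matrix (Fin m) (Fin n) ℝ) (N : Matrix (Fin n) (Fin n) ℝ) (K : Matrix (Fin m) (Fin m) ℝ) :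
    maxNorm (Gᵀ * (L * N + K * L)) ≤ xi G L * ‖L * N + K * L‖ := by
  set B := L * N + K * L with hB
  rcases (norm_nonneg B).eq_or_lt with h | h
  · rw [norm_eq_zero.1 h.symm]
    simp [maxNorm]
  · rw [← div_le_iff₀ h]
    refine le_csSup ⟨‖Gᵀ‖, ?_⟩ ⟨‖B‖⁻¹ • B, ?_, ?_, ?_⟩
    · rintro _ ⟨D, -, hD, rfl⟩
      refine maxNorm_le (norm_nonneg _) fun i j => (abs_apply_le_norm _ i j).trans ?_
      exact norm_mul_le_of_right _ hD
    · have : ‖B‖⁻¹ • B = L * (‖B‖⁻¹ • N) + (‖B‖⁻¹ • K) * L := by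
        rw [hB, smul_add, Matrix.mul_smul, Matrix.smul_mul]
      rw [this]
      exact mul_add_mul_mem_tangentSpace _ _ _
    · rw [spectralNorm_eq_norm, norm_smul, norm_inv, norm_norm, inv_mul_cancel₀ h.ne']
    · rw [Matrix.mul_smul, maxNorm_smul, abs_of_pos (inv_pos.2 h), div_eq_inv_mul]

end Incoherence

/-! ### Polar factors, duality and subgradients of the nuclear norm. -/

section NuclearNorm

variable {m n : ℕ}

/-- Singular values past the rank vanish; the index set `Fin n` matches an eigenbasis of `Yᵀ Y`. -/
theorem nuclearNorm_eq_sum_fin (Y : Matrix (Fin m) (Fin n) ℝ) :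
    nuclearNorm Y = ∑ i : Fin n, (toEuclideanLin Y).singularValues i := by
  rw [nuclearNorm, ← Fin.sum_univ_eq_sum_range
    (fun i => (toEuclideanLin Y).singularValues i), Fin.sum_univ_eq_sum_range
    (fun i => (toEuclideanLin Y).singularValues i), Fin.sum_univ_eq_sum_range
    (fun i => (toEuclideanLin Y).singularValues i)]
  refine Finset.sum_subset (Finset.range_subset_range.2 ?_) fun i _ hi => ?_
  · simpa using rank_le_width Y
  · rw [LinearMap.singularValues_eq_zero_iff_le_finrank_range]
    rw [Finset.mem_range, not_lt, rank_eq_finrank_range_toLin Y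
      (EuclideanSpace.basisFun (Fin m) ℝ).toBasis (EuclideanSpace.basisFun (Fin n) ℝ).toBasis,
      ← toEuclideanLin_eq_toLin_orthonormal] at hi
    exact hi

theorem exists_orthonormalBasis_adjoint_apply
    (T : EuclideanSpace ℝ (Fin n) →ₗ[ℝ] EuclideanSpace ℝ (Fin m)) :
    ∃ b : OrthonormalBasis (Fin n) ℝ (EuclideanSpace ℝ (Fin n)),
      ∀ i, T.adjoint (T (b i)) = (T.singularValues i ^ 2) • b i := by
  have hn : Module.finrank ℝ (EuclideanSpace ℝ (Fin n)) = n := by simp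
  refine ⟨T.isSymmetric_adjoint_comp_self.eigenvectorBasis hn, fun i => ?_⟩
  rw [T.sq_singularValues_fin hn]
  exact T.isSymmetric_adjoint_comp_self.apply_eigenvectorBasis hn i

theorem exists_orthogonal_gram_diagonal (Y : Matrix (Fin m) (Fin n) ℝ) :
    ∃ (B : Matrix (Fin n) (Fin n) ℝ) (s : Fin n → ℝ), Bᵀ * B = 1 ∧ B * Bᵀ = 1 ∧ (∀ i, 0 ≤ s i) ∧
      (Y * B)ᵀ * (Y * B) = diagonal (fun i => s i ^ 2) ∧ nuclearNorm Y = ∑ i, s i := by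
  obtain ⟨b, hb⟩ := exists_orthonormalBasis_adjoint_apply (toEuclideanLin Y)
  have hB : (of fun k i => b i k : Matrix (Fin n) (Fin n) ℝ)ᵀ * (of fun k i => b i k) = 1 := by
    ext i j
    have := orthonormal_iff_ite.1 b.orthonormal i j
    rw [PiLp.inner_apply] at this
    simpa [mul_apply, one_apply, mul_comm] using this
  refine ⟨of fun k i => b i k, fun i => (toEuclideanLin Y).singularValues i, hB,
    mul_eq_one_comm.1 hB, fun i => LinearMap.singularValues_nonneg _ i, ?_,
    nuclearNorm_eq_sum_fin Y⟩
  ext i j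
  have h1 : inner ℝ (toEuclideanLin Y (b i)) (toEuclideanLin Y (b j)) =
      if i = j then (toEuclideanLin Y).singularValues i ^ 2 else 0 := by
    rw [← LinearMap.adjoint_inner_right, hb, inner_smul_right,
      orthonormal_iff_ite.1 b.orthonormal i j]
    split_ifs with h
    · rw [h, mul_one]
    · rw [mul_zero]
  rw [diagonal_apply, ← h1, PiLp.inner_apply, mul_apply]
  refine Finset.sum_congr rfl fun k _ => ?_
  simp [mul_apply, toLpLin_apply, mulVec, dotProduct, mul_comm]

/-- `E` is a partial isometry with `Y = E |Y|`, where `|Y|` is the positive square root of `Yᵀ Y`;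
its column and row spaces are those of `Y`. -/
structure IsPolarFactor (Y E : Matrix (Fin m) (Fin n) ℝ) : Prop where
  mul_transpose_mul : E * Eᵀ * E = E
  proj_mul : E * Eᵀ * Y = Y
  exists_right : ∃ J : Matrix (Fin n) (Fin n) ℝ, E = Y * J
  exists_left : ∃ J : Matrix (Fin m) (Fin m) ℝ, E = J * Y
  trace_eq : trace (Eᵀ * Y) = nuclearNorm Y
  exists_diagonal : ∃ (B : Matrix (Fin n) (Fin n) ℝ) (s : Fin n → ℝ), ‖B‖ ≤ 1 ∧ (∀ i, 0 ≤ s i) ∧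
    Eᵀ * Y = B * diagonal s * Bᵀ ∧ nuclearNorm Y = ∑ i, s i

/-- With right singular vectors as the columns of `B`, take `E = Y |Y|⁺`, where `|Y|⁺ = B d Bᵀ` is
the pseudoinverse of `|Y| = B e Bᵀ`. -/
theorem exists_isPolarFactor (Y : Matrix (Fin m) (Fin n) ℝ) : ∃ E, IsPolarFactor Y E := by
  obtain ⟨B, s, hB, hB', hs, hG, hY⟩ := exists_orthogonal_gram_diagonal Y
  -- Because `0⁻¹ = 0`, `d` is the pseudoinverse of `e`, and `u` projects onto the indices with
  -- nonzero singular value.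
  set d := diagonal (fun i => (s i)⁻¹) with hd
  set e := diagonal s with he
  set u := diagonal (fun i => if s i = 0 then (0 : ℝ) else 1) with hu
  have hdt : dᵀ = d := diagonal_transpose _
  have hde : d * e = u := by
    rw [hd, he, hu, diagonal_mul_diagonal]
    congr 1; ext i; split_ifs with h <;> simp [h]
  have hdu : d * u = d := by
    rw [hd, hu, diagonal_mul_diagonal]
    congr 1; ext i; split_ifs with h <;> simp [h]
  have hG' : (Y * B)ᵀ * (Y * B) = e * e := by
    rw [hG, he, diagonal_mul_diagonal]
    congr 1; ext i; ring
  have hed : e * d = u := by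
    rw [← hde, hd, he, diagonal_mul_diagonal, diagonal_mul_diagonal]; simp only [mul_comm]
  have hue : u * e = e := by
    rw [he, hu, diagonal_mul_diagonal]
    congr 1; ext i; split_ifs with h <;> simp [h]
  have heu : e * (1 - u) = 0 := by
    rw [Matrix.mul_sub, Matrix.mul_one, sub_eq_zero, ← hed, ← Matrix.mul_assoc]
    rw [he, hd, diagonal_mul_diagonal, diagonal_mul_diagonal]
    congr 1; ext i; by_cases h : s i = 0 <;> simp [h]
  -- The columns of `Y B` with zero singular value vanish, since their Gram matrix does.
  have hYu : Y * B * u = Y * B := by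
    have h0 : ((Y * B) * (1 - u))ᴴ * ((Y * B) * (1 - u)) = 0 := by
      rw [conjTranspose_eq_transpose_of_trivial, transpose_mul, Matrix.mul_assoc,
        ← Matrix.mul_assoc (Y * B)ᵀ, hG', Matrix.mul_assoc e, heu, Matrix.mul_zero, Matrix.mul_zero]
    have := conjTranspose_mul_self_eq_zero.1 h0
    rw [Matrix.mul_sub, Matrix.mul_one, sub_eq_zero] at this
    exact this.symm
  set E := Y * B * d * Bᵀ with hE
  have hEt : Eᵀ = B * d * (Y * B)ᵀ := by
    rw [hE, transpose_mul, transpose_mul, transpose_transpose, hdt, Matrix.mul_assoc]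
  have hYB : Y = Y * B * Bᵀ := by rw [Matrix.mul_assoc, hB', Matrix.mul_one]
  have hEY : Eᵀ * Y = B * e * Bᵀ := by
    calc Eᵀ * Y = B * d * (Y * B)ᵀ * (Y * B * Bᵀ) := by rw [← hYB, hEt]
      _ = B * d * ((Y * B)ᵀ * (Y * B)) * Bᵀ := by simp only [Matrix.mul_assoc]
      _ = B * (d * e * e) * Bᵀ := by rw [hG']; simp only [Matrix.mul_assoc]
      _ = B * e * Bᵀ := by
        rw [hde, hue]
  have hEE : Eᵀ * E = B * u * Bᵀ := by
    rw [hEt]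
    calc B * d * (Y * B)ᵀ * (Y * B * d * Bᵀ)
        = B * d * ((Y * B)ᵀ * (Y * B)) * d * Bᵀ := by simp only [Matrix.mul_assoc]
      _ = B * ((d * e) * e * d) * Bᵀ := by rw [hG']; simp only [Matrix.mul_assoc]
      _ = B * u * Bᵀ := by rw [hde, hue, hed]
  have h1 : E * Eᵀ * E = E := by
    rw [Matrix.mul_assoc, hEE, hE]
    calc Y * B * d * Bᵀ * (B * u * Bᵀ) = Y * B * d * (Bᵀ * B) * u * Bᵀ := by
          simp only [Matrix.mul_assoc]
      _ = Y * B * (d * u) * Bᵀ := by rw [hB, Matrix.mul_one]; simp only [Matrix.mul_assoc]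
      _ = _ := by rw [hdu]
  refine ⟨E, h1, ?_, ⟨B * d * Bᵀ, by simp only [hE, Matrix.mul_assoc]⟩, ⟨E * (B * d * Bᵀ) * Eᵀ, ?_⟩,
    ?_, ⟨B, s, ?_, hs, hEY, hY⟩⟩
  · rw [Matrix.mul_assoc, hEY, hE]
    calc Y * B * d * Bᵀ * (B * e * Bᵀ) = Y * B * d * (Bᵀ * B) * e * Bᵀ := by
          simp only [Matrix.mul_assoc]
      _ = Y * B * (d * e) * Bᵀ := by rw [hB, Matrix.mul_one]; simp only [Matrix.mul_assoc]
      _ = _ := by rw [hde, hYu, ← hYB]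
  · calc E = E * (Eᵀ * E) := by rw [← Matrix.mul_assoc, h1]
      _ = E * (B * (d * e) * Bᵀ) := by rw [hEE, hde]
      _ = E * (B * d * (Bᵀ * B) * e * Bᵀ) := by
        rw [hB, Matrix.mul_one]; simp only [Matrix.mul_assoc]
      _ = E * (B * d * Bᵀ) * (Eᵀ * Y) := by rw [hEY]; simp only [Matrix.mul_assoc]
      _ = _ := by simp only [Matrix.mul_assoc]
  · rw [hEY, trace_mul_comm, ← Matrix.mul_assoc, hB, Matrix.one_mul, he, trace_diagonal, hY]
  · refine norm_le_one_of_transpose_mul_self ?_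
    rw [hB]
    exact norm_le_one_of_symm_idem transpose_one (Matrix.one_mul 1)

namespace IsPolarFactor

variable {Y E : Matrix (Fin m) (Fin n) ℝ}

theorem norm_rightProj_le (h : IsPolarFactor Y E) : ‖Eᵀ * E‖ ≤ 1 :=
  norm_le_one_of_symm_idem (by simp)
    (by rw [Matrix.mul_assoc, ← Matrix.mul_assoc E, h.mul_transpose_mul])

theorem norm_leftProj_le (h : IsPolarFactor Y E) : ‖E * Eᵀ‖ ≤ 1 :=
  norm_le_one_of_symm_idem (by simp) (by rw [← Matrix.mul_assoc, h.mul_transpose_mul])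

theorem norm_one_sub_rightProj_le (h : IsPolarFactor Y E) : ‖1 - Eᵀ * E‖ ≤ 1 :=
  norm_le_one_of_symm_idem (by simp) (by
    have : Eᵀ * E * (Eᵀ * E) = Eᵀ * E := by
      rw [Matrix.mul_assoc, ← Matrix.mul_assoc E, h.mul_transpose_mul]
    simp [Matrix.mul_sub, Matrix.sub_mul, this])

theorem norm_one_sub_leftProj_le (h : IsPolarFactor Y E) : ‖1 - E * Eᵀ‖ ≤ 1 :=
  norm_le_one_of_symm_idem (by simp) (by
    have : E * Eᵀ * (E * Eᵀ) = E * Eᵀ := by rw [← Matrix.mul_assoc, h.mul_transpose_mul]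
    simp [Matrix.mul_sub, Matrix.sub_mul, this])

theorem norm_le_one (h : IsPolarFactor Y E) : ‖E‖ ≤ 1 :=
  norm_le_one_of_transpose_mul_self h.norm_rightProj_le

end IsPolarFactor

/-- Duality of the spectral and the nuclear norm. -/
theorem trace_transpose_mul_le (Q Y : Matrix (Fin m) (Fin n) ℝ) :
    trace (Qᵀ * Y) ≤ ‖Q‖ * nuclearNorm Y := by
  obtain ⟨E, h⟩ := exists_isPolarFactor Y
  obtain ⟨B, s, hB, hs, hEY, hY⟩ := h.exists_diagonal
  -- In the singular basis the trace is a combination of the `s i`, whose coefficients are diagonal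
  -- entries of a matrix of norm at most `‖Q‖`.
  have h1 : trace (Qᵀ * Y) = ∑ i, (Bᵀ * (Qᵀ * E) * B) i i * s i := by
    calc trace (Qᵀ * Y) = trace (Qᵀ * E * (Eᵀ * Y)) := by
          conv_lhs => rw [← h.proj_mul]
          simp only [Matrix.mul_assoc]
      _ = trace ((Qᵀ * E * B * diagonal s) * Bᵀ) := by rw [hEY]; simp only [Matrix.mul_assoc]
      _ = trace (Bᵀ * (Qᵀ * E) * B * diagonal s) := by
          rw [trace_mul_comm]; simp only [Matrix.mul_assoc]
      _ = _ := by simp [trace, mul_diagonal]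
  rw [h1, hY, Finset.mul_sum]
  refine Finset.sum_le_sum fun i _ => mul_le_mul_of_nonneg_right ?_ (hs i)
  refine (le_abs_self _).trans ((abs_apply_le_norm _ i i).trans ?_)
  refine (norm_mul_le_of_right _ hB).trans ?_
  refine (norm_mul_le_of_left (by rwa [norm_transpose]) _).trans ?_
  exact (norm_mul_le_of_right _ h.norm_le_one).trans (norm_transpose Q).le

/-- The two summands have orthogonal ranges and orthogonal initial spaces. With `R = Eᵀ E`, `‖(E +
G)x‖² = ‖R x‖² + ‖G(1 - R)x‖²`, which is at most `‖R x‖² + ‖(1 - R)x‖² = ‖x‖²`. -/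
theorem IsPolarFactor.norm_add_le_one {Y E : Matrix (Fin m) (Fin n) ℝ} (h : IsPolarFactor Y E)
    {X : Matrix (Fin m) (Fin n) ℝ} (hX : ‖(1 - E * Eᵀ) * X * (1 - Eᵀ * E)‖ ≤ 1) :
    ‖E + (1 - E * Eᵀ) * X * (1 - Eᵀ * E)‖ ≤ 1 := by
  set R := Eᵀ * E with hR
  set G := (1 - E * Eᵀ) * X * (1 - R) with hG
  have hRt : Rᵀ = R := by simp [hR]
  have hRR : R * R = R := by
    rw [hR, Matrix.mul_assoc, ← Matrix.mul_assoc E, h.mul_transpose_mul]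
  have hEG : Eᵀ * G = 0 := by
    have : Eᵀ * (1 - E * Eᵀ) = 0 := by
      have := congrArg transpose h.mul_transpose_mul
      simp only [transpose_mul, transpose_transpose] at this
      rw [Matrix.mul_sub, Matrix.mul_one, this, sub_self]
    rw [hG, ← Matrix.mul_assoc, ← Matrix.mul_assoc, this, Matrix.zero_mul, Matrix.zero_mul]
  have hGE : Gᵀ * E = 0 := by simpa using congrArg transpose hEG
  have hGR : G * (1 - R) = G := by
    have : (1 - R) * (1 - R) = 1 - R := by simp [Matrix.mul_sub, Matrix.sub_mul, hRR]
    rw [hG, Matrix.mul_assoc, this]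
  refine norm_le_one_of_dotProduct_le _ fun x => ?_
  have e1 : ((E + G) *ᵥ x) ⬝ᵥ ((E + G) *ᵥ x) = x ⬝ᵥ (R *ᵥ x) + (G *ᵥ x) ⬝ᵥ (G *ᵥ x) := by
    have : (E + G)ᵀ * (E + G) = R + Gᵀ * G := by
      rw [transpose_add, Matrix.add_mul, Matrix.mul_add, Matrix.mul_add, hEG, hGE]
      simp [hR]
    have key : ∀ A : Matrix (Fin m) (Fin n) ℝ, (A *ᵥ x) ⬝ᵥ (A *ᵥ x) = x ⬝ᵥ ((Aᵀ * A) *ᵥ x) := by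
      intro A
      rw [← mulVec_mulVec, dotProduct_mulVec x, vecMul_transpose]
    rw [key, key, this, add_mulVec, dotProduct_add]
  have e2 : (G *ᵥ x) ⬝ᵥ (G *ᵥ x) ≤ x ⬝ᵥ x - x ⬝ᵥ (R *ᵥ x) := by
    have h1 := dotProduct_mulVec_self_le G ((1 - R) *ᵥ x)
    rw [mulVec_mulVec, hGR] at h1
    have h2 : ((1 - R) *ᵥ x) ⬝ᵥ ((1 - R) *ᵥ x) = x ⬝ᵥ x - x ⬝ᵥ (R *ᵥ x) := by
      have h3 : (R *ᵥ x) ⬝ᵥ (R *ᵥ x) = x ⬝ᵥ (R *ᵥ x) := by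
        conv_rhs => rw [← hRR, ← mulVec_mulVec, dotProduct_mulVec, ← mulVec_transpose, hRt]
      rw [sub_mulVec, one_mulVec, dotProduct_sub, sub_dotProduct, sub_dotProduct, h3,
        dotProduct_comm (R *ᵥ x) x]
      ring
    rw [h2] at h1
    refine h1.trans (mul_le_of_le_one_left ?_ (pow_le_one₀ (norm_nonneg _) hX))
    rw [← h2, ← norm_toLp_sq]
    positivity
  rw [e1]
  linarith

/-- The subgradient inequality for the nuclear norm at `Y`. -/
theorem IsPolarFactor.nuclearNorm_add_ge {Y E : Matrix (Fin m) (Fin n) ℝ} (h : IsPolarFactor Y E)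
    {X : Matrix (Fin m) (Fin n) ℝ} (hX : ‖(1 - E * Eᵀ) * X * (1 - Eᵀ * E)‖ ≤ 1)
    (Z : Matrix (Fin m) (Fin n) ℝ) :
    nuclearNorm Y + trace ((E + (1 - E * Eᵀ) * X * (1 - Eᵀ * E))ᵀ * Z) ≤ nuclearNorm (Y + Z) := by
  have h1 := trace_transpose_mul_le (E + (1 - E * Eᵀ) * X * (1 - Eᵀ * E)) (Y + Z)
  have h2 : 0 ≤ nuclearNorm (Y + Z) :=
    Finset.sum_nonneg fun i _ => LinearMap.singularValues_nonneg _ i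
  have h3 := h1.trans (mul_le_of_le_one_left h2 (h.norm_add_le_one hX))
  have h4 : ((1 - E * Eᵀ) * X * (1 - Eᵀ * E))ᵀ * Y = 0 := by
    have : (1 - E * Eᵀ) * Y = 0 := by rw [Matrix.sub_mul, h.proj_mul, Matrix.one_mul, sub_self]
    rw [transpose_mul, transpose_mul, Matrix.mul_assoc, Matrix.mul_assoc]
    simp [this]
  have h5 : (E + (1 - E * Eᵀ) * X * (1 - Eᵀ * E))ᵀ * Y = Eᵀ * Y := by
    rw [transpose_add, Matrix.add_mul, h4, add_zero]
  rwa [Matrix.mul_add, trace_add, h5, h.trace_eq] at h3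

end NuclearNorm

/-! ### Tangential and normal parts at a matrix with a given polar factor. -/

section TangentDecomposition

variable {m n p : ℕ}

/-- The projection onto the orthogonal complement of the tangent space at a matrix with polar
factor `E`. -/
noncomputable def normalPart (E : Matrix (Fin m) (Fin n) ℝ) :
    Matrix (Fin m) (Fin n) ℝ →ₗ[ℝ] Matrix (Fin m) (Fin n) ℝ where
  toFun X := (1 - E * Eᵀ) * X * (1 - Eᵀ * E)
  map_add' X Z := by rw [Matrix.mul_add, Matrix.add_mul]
  map_smul' c X := by simp

theorem normalPart_apply (E X : Matrix (Fin m) (Fin n) ℝ) :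
    normalPart E X = (1 - E * Eᵀ) * X * (1 - Eᵀ * E) := rfl

theorem sub_normalPart (E X : Matrix (Fin m) (Fin n) ℝ) :
    X - normalPart E X = E * Eᵀ * X + (1 - E * Eᵀ) * X * (Eᵀ * E) := by
  rw [normalPart_apply, Matrix.mul_sub, Matrix.mul_one, Matrix.sub_mul, Matrix.one_mul]
  abel

/-- `normalPart E` is an orthogonal projection for the trace inner product. -/
theorem trace_normalPart_mul (E X : Matrix (Fin m) (Fin n) ℝ)
    (h : E * Eᵀ * E = E) :
    trace ((normalPart E X)ᵀ * X) = trace ((normalPart E X)ᵀ * normalPart E X) := by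
  have hP : (1 - E * Eᵀ) * (1 - E * Eᵀ) = 1 - E * Eᵀ := by
    have : E * Eᵀ * (E * Eᵀ) = E * Eᵀ := by rw [← Matrix.mul_assoc, h]
    simp [Matrix.mul_sub, Matrix.sub_mul, this]
  have hR : (1 - Eᵀ * E) * (1 - Eᵀ * E) = 1 - Eᵀ * E := by
    have : Eᵀ * E * (Eᵀ * E) = Eᵀ * E := by rw [Matrix.mul_assoc, ← Matrix.mul_assoc E, h]
    simp [Matrix.mul_sub, Matrix.sub_mul, this]
  have ht : (normalPart E X)ᵀ = (1 - Eᵀ * E) * (Xᵀ * (1 - E * Eᵀ)) := by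
    simp [normalPart_apply, transpose_mul]
  symm
  calc trace ((normalPart E X)ᵀ * normalPart E X)
      = trace ((1 - Eᵀ * E) * (Xᵀ * ((1 - E * Eᵀ) * (1 - E * Eᵀ)) * X * (1 - Eᵀ * E))) := by
        rw [ht, normalPart_apply]; simp only [Matrix.mul_assoc]
    _ = trace (Xᵀ * (1 - E * Eᵀ) * X * ((1 - Eᵀ * E) * (1 - Eᵀ * E))) := by
        rw [trace_mul_comm, hP]; simp only [Matrix.mul_assoc]
    _ = trace ((1 - Eᵀ * E) * (Xᵀ * (1 - E * Eᵀ) * X)) := by rw [hR, trace_mul_comm]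
    _ = _ := by rw [ht]; simp only [Matrix.mul_assoc]

variable {Y E : Matrix (Fin m) (Fin n) ℝ}

theorem IsPolarFactor.norm_normalPart_le (h : IsPolarFactor Y E) (X : Matrix (Fin m) (Fin n) ℝ) :
    ‖normalPart E X‖ ≤ ‖X‖ :=
  (norm_mul_le_of_right _ h.norm_one_sub_rightProj_le).trans
    (norm_mul_le_of_left h.norm_one_sub_leftProj_le _)

/-- The factor 2 counts the two summands of `sub_normalPart`, each a compression of `X` by
projections. -/
theorem IsPolarFactor.norm_sub_normalPart_le (h : IsPolarFactor Y E)
    (X : Matrix (Fin m) (Fin n) ℝ) : ‖X - normalPart E X‖ ≤ 2 * ‖X‖ := by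
  rw [sub_normalPart, two_mul]
  refine (norm_add_le _ _).trans (add_le_add (norm_mul_le_of_left h.norm_leftProj_le _) ?_)
  exact (norm_mul_le_of_right _ h.norm_rightProj_le).trans
    (norm_mul_le_of_left h.norm_one_sub_leftProj_le _)

theorem IsPolarFactor.maxNorm_transpose_mul_self_le (h : IsPolarFactor Y E)
    (G : Matrix (Fin m) (Fin p) ℝ) : maxNorm (Gᵀ * E) ≤ xi G Y := by
  obtain ⟨J, hJ⟩ := h.exists_right
  have h1 := maxNorm_transpose_mul_le_xi G Y J 0
  rw [Matrix.zero_mul, add_zero, ← hJ] at h1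
  exact h1.trans (mul_le_of_le_one_right (xi_nonneg _ _) h.norm_le_one)

/-- Writing `E = Y J = K Y` puts the tangential part in the form `Y N + K' Y`. -/
theorem IsPolarFactor.maxNorm_transpose_mul_sub_normalPart_le (h : IsPolarFactor Y E)
    (G : Matrix (Fin m) (Fin p) ℝ) (X : Matrix (Fin m) (Fin n) ℝ) :
    maxNorm (Gᵀ * (X - normalPart E X)) ≤ xi G Y * ‖X - normalPart E X‖ := by
  obtain ⟨J, hJ⟩ := h.exists_right
  obtain ⟨K, hK⟩ := h.exists_left
  have : X - normalPart E X = Y * (J * Eᵀ * X) + ((1 - E * Eᵀ) * X * Eᵀ * K) * Y := by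
    rw [sub_normalPart]
    congr 1
    · conv_lhs => enter [1, 1]; rw [hJ]
      simp only [Matrix.mul_assoc]
    · conv_lhs => enter [2, 2]; rw [hK]
      simp only [Matrix.mul_assoc]
  rw [this]
  exact maxNorm_transpose_mul_le_xi G Y _ _

end TangentDecomposition

/-! ### Construction of the dual certificate. -/

section Certificate

variable {m n p : ℕ}

/-- Entrywise restriction to the support of `S`. -/
noncomputable def supportProj (S : Matrix (Fin p) (Fin n) ℝ) :
    Matrix (Fin p) (Fin n) ℝ →ₗ[ℝ] Matrix (Fin p) (Fin n) ℝ where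
  toFun A := of fun i j => if S i j = 0 then 0 else A i j
  map_add' A B := by ext i j; simp only [of_apply, Matrix.add_apply]; split_ifs <;> simp
  map_smul' c A := by ext i j; simp

theorem supportProj_apply (S A : Matrix (Fin p) (Fin n) ℝ) (i : Fin p) (j : Fin n) :
    supportProj S A i j = if S i j = 0 then 0 else A i j := rfl

theorem supportProj_mem (S A : Matrix (Fin p) (Fin n) ℝ) : supportProj S A ∈ Omega S :=
  fun i j h => by rw [supportProj_apply, if_pos h]

theorem supportProj_eq_self {S A : Matrix (Fin p) (Fin n) ℝ} (hA : A ∈ Omega S) :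
    supportProj S A = A := by
  ext i j
  rw [supportProj_apply]
  split_ifs with h
  · exact (hA i j h).symm
  · rfl

variable {W : Matrix (Fin m) (Fin p) ℝ} {S A : Matrix (Fin p) (Fin n) ℝ}
  {Y E : Matrix (Fin m) (Fin n) ℝ} {δ : ℝ}

/-- The central contraction estimate: `δ` bounds the failure of `Wᵀ W` to be the identity on `Ω(S)`,
and `2μξ` bounds the contribution of the tangential part of `W A`. It serves both for the
certificate and for uniqueness. -/
theorem abs_sub_transpose_mul_normalPart_le (hE : IsPolarFactor Y E)
    (hW : ∀ A ∈ Omega S, maxNorm (A - Wᵀ * W * A) ≤ δ * maxNorm A) (hA : A ∈ Omega S)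
    (i : Fin p) (j : Fin n) :
    |(A - Wᵀ * normalPart E (W * A)) i j| ≤ (δ + 2 * (mu W S * xi W Y)) * maxNorm A := by
  have h1 : A - Wᵀ * normalPart E (W * A) =
      (A - Wᵀ * W * A) + Wᵀ * (W * A - normalPart E (W * A)) := by
    rw [Matrix.mul_sub, Matrix.mul_assoc]; abel
  have h2 := (abs_apply_le_maxNorm _ i j).trans (hW A hA)
  have h3 := (abs_apply_le_maxNorm _ i j).trans
    (hE.maxNorm_transpose_mul_sub_normalPart_le W (W * A))
  have h4 : ‖W * A - normalPart E (W * A)‖ ≤ 2 * (mu W S * maxNorm A) :=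
    (hE.norm_sub_normalPart_le _).trans
      (mul_le_mul_of_nonneg_left (norm_mul_le_mu W hA) zero_le_two)
  have h5 := mul_le_mul_of_nonneg_left h4 (xi_nonneg W Y)
  rw [h1, Matrix.add_apply]
  refine (abs_add_le _ _).trans ?_
  linarith

theorem eq_zero_of_le_mul_maxNorm {c : ℝ} (hc : c < 1) (hc0 : 0 ≤ c)
    (h : ∀ i j, |A i j| ≤ c * maxNorm A) : A = 0 := by
  have h1 := maxNorm_le (mul_nonneg hc0 (maxNorm_nonneg A)) h
  refine eq_zero_of_maxNorm_le ?_
  nlinarith [maxNorm_nonneg A]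

theorem exists_certificate (hE : IsPolarFactor Y E) (hδ : 0 ≤ δ)
    (hW : ∀ A ∈ Omega S, maxNorm (A - Wᵀ * W * A) ≤ δ * maxNorm A)
    (hc : δ + 2 * (mu W S * xi W Y) < 1) {γ : ℝ} (hγ : 0 ≤ γ) :
    ∃ A ∈ Omega S,
      maxNorm A ≤ γ + xi W Y + (δ + 2 * (mu W S * xi W Y)) * maxNorm A ∧
      (∀ i j, S i j ≠ 0 → (Wᵀ * (E + normalPart E (W * A))) i j = γ * SignType.sign (S i j)) ∧
      (∀ i j, S i j = 0 → |(Wᵀ * (E + normalPart E (W * A))) i j| ≤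
        xi W Y + (δ + 2 * (mu W S * xi W Y)) * maxNorm A) := by
  set c := δ + 2 * (mu W S * xi W Y) with hcdef
  have hc0 : 0 ≤ c := by
    have := mul_nonneg (mu_nonneg W S) (xi_nonneg W Y)
    positivity
  -- The support projections extend the operator `A ↦ P_Ω Wᵀ N(W A)` on `Ω(S)` to an endomorphism of
  -- the whole finite-dimensional space, where injectivity yields surjectivity.
  let Φ : Matrix (Fin p) (Fin n) ℝ →ₗ[ℝ] Matrix (Fin p) (Fin n) ℝ :=
    { toFun := fun A => A - supportProj S
        (supportProj S A - Wᵀ * normalPart E (W * supportProj S A))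
      map_add' := fun A B => by
        simp only [map_add, Matrix.mul_add, map_sub]; abel
      map_smul' := fun t A => by
        simp only [map_smul, Matrix.mul_smul, map_sub, RingHom.id_apply, smul_sub] }
  have hΦ : ∀ A, Φ A = A - supportProj S
        (supportProj S A - Wᵀ * normalPart E (W * supportProj S A)) := fun _ => rfl
  have hinj : Function.Injective Φ := by
    rw [injective_iff_map_eq_zero]
    intro A hA
    rw [hΦ, sub_eq_zero] at hA
    have hmem : A ∈ Omega S := by rw [hA]; exact supportProj_mem _ _
    rw [supportProj_eq_self hmem] at hA
    refine eq_zero_of_le_mul_maxNorm hc hc0 fun i j => ?_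
    have h1 := abs_sub_transpose_mul_normalPart_le hE hW hmem i j
    by_cases h : S i j = 0
    · rw [hmem i j h, abs_zero]
      exact mul_nonneg hc0 (maxNorm_nonneg A)
    · have h2 := congrFun (congrFun hA i) j
      rw [supportProj_apply, if_neg h] at h2
      rw [h2]
      exact h1
  obtain ⟨A, hA⟩ := LinearMap.injective_iff_surjective.1 hinj
    (supportProj S (of (fun i j => γ * (SignType.sign (S i j) : ℝ)) - Wᵀ * E))
  rw [hΦ, sub_eq_iff_eq_add, ← map_add] at hA
  have hmem : A ∈ Omega S := by rw [hA]; exact supportProj_mem _ _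
  rw [supportProj_eq_self hmem] at hA
  have hon : ∀ i j, S i j ≠ 0 → A i j =
      γ * SignType.sign (S i j) - (Wᵀ * E) i j + (A - Wᵀ * normalPart E (W * A)) i j := by
    intro i j h
    have h2 := congrFun (congrFun hA i) j
    rwa [supportProj_apply, if_neg h, Matrix.add_apply, Matrix.sub_apply, of_apply] at h2
  have hWE : ∀ i j, |(Wᵀ * E) i j| ≤ xi W Y := fun i j =>
    (abs_apply_le_maxNorm _ i j).trans (hE.maxNorm_transpose_mul_self_le W)
  have hR : ∀ i j, |(A - Wᵀ * normalPart E (W * A)) i j| ≤ c * maxNorm A :=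
    abs_sub_transpose_mul_normalPart_le hE hW hmem
  have hxi := xi_nonneg W Y
  have hcA := mul_nonneg hc0 (maxNorm_nonneg A)
  refine ⟨A, hmem, maxNorm_le (by positivity) fun i j => ?_, fun i j h => ?_, fun i j h => ?_⟩
  · by_cases h : S i j = 0
    · rw [hmem i j h, abs_zero]
      positivity
    · rw [hon i j h]
      refine (abs_add_le _ _).trans (add_le_add ((abs_sub _ _).trans (add_le_add ?_ (hWE i j)))
        (hR i j))
      rw [abs_mul, abs_of_nonneg hγ]
      refine mul_le_of_le_one_right hγ ?_
      rcases lt_or_gt_of_ne h with h | h <;> simp [h]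
  · have := hon i j h
    rw [Matrix.sub_apply] at this
    rw [Matrix.mul_add, Matrix.add_apply]
    linarith
  · have h1 := hR i j
    rw [Matrix.sub_apply, hmem i j h, zero_sub, abs_neg] at h1
    rw [Matrix.mul_add, Matrix.add_apply]
    exact (abs_add_le _ _).trans (add_le_add (hWE i j) h1)

/-- A tradeoff parameter for which the certificate is strict. -/
theorem exists_tradeoff {a b δ : ℝ} (ha : 0 ≤ a) (hb : 0 ≤ b) (hδ : δ < 1 / 3) (hδ0 : 0 ≤ δ)
    (hab : a * b < (1 - 3 * δ) / 6) :
    ∃ γ : ℝ, 0 < γ ∧ ∀ t, 0 ≤ t → t ≤ γ + b + (δ + 2 * (a * b)) * t →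
      a * t < 1 ∧ b + (δ + 2 * (a * b)) * t < γ := by
  have hab0 : 0 ≤ a * b := mul_nonneg ha hb
  have h1 : 1 / 3 < 1 - 2 * δ - 4 * (a * b) := by linarith
  have h2 : 1 / 2 < 1 - δ - 3 * (a * b) := by linarith
  -- With `c = δ + 2ab`, the hypothesis on `t` says `t ≤ (γ + b)/(1 - c)`; inserting this bound in
  -- the two goals gives exactly these conditions on `γ`. The interval they define is nonempty
  -- because `ab < 1/6 = (1/3)(1/2)`; for `a = 0` it has no upper end.
  obtain ⟨γ, hγ0, hγ1, hγ2⟩ : ∃ γ : ℝ, 0 < γ ∧ b < γ * (1 - 2 * δ - 4 * (a * b)) ∧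
      a * γ < 1 - δ - 3 * (a * b) := by
    have h0 : 0 < 1 - 2 * δ - 4 * (a * b) := by linarith
    rcases ha.eq_or_lt with rfl | ha
    · refine ⟨b / (1 - 2 * δ - 4 * (0 * b)) + 1, by positivity, ?_, by linarith⟩
      rw [← div_lt_iff₀ h0]
      linarith
    · have hlt : b / (1 - 2 * δ - 4 * (a * b)) < (1 - δ - 3 * (a * b)) / a := by
        rw [div_lt_div_iff₀ h0 ha]
        nlinarith
      obtain ⟨γ, hl, hu⟩ := exists_between hlt
      exact ⟨γ, (div_nonneg hb h0.le).trans_lt hl, (div_lt_iff₀ h0).1 hl, by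
        rwa [lt_div_iff₀ ha, mul_comm] at hu⟩
  refine ⟨γ, hγ0, fun t ht0 ht => ?_⟩
  have h3 : 0 < 1 - δ - 2 * (a * b) := by linarith
  have h4 : (1 - δ - 2 * (a * b)) * t ≤ γ + b := by linarith
  constructor
  · have : (1 - δ - 2 * (a * b)) * (a * t) < (1 - δ - 2 * (a * b)) * 1 := by
      have := mul_le_mul_of_nonneg_left h4 ha
      linarith
    exact lt_of_mul_lt_mul_left this h3.le
  · have : (1 - δ - 2 * (a * b)) * (b + (δ + 2 * (a * b)) * t) < (1 - δ - 2 * (a * b)) * γ := by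
      have h5 := mul_le_mul_of_nonneg_left h4 (by linarith : 0 ≤ δ + 2 * (a * b))
      linarith
    exact lt_of_mul_lt_mul_left this h3.le

end Certificate

/-! ### Uniqueness of the minimiser and the projection onto the kernel. -/

section Recovery

variable {m n p : ℕ}

theorem trace_transpose_mul_eq_sum (A B : Matrix (Fin p) (Fin n) ℝ) :
    trace (Aᵀ * B) = ∑ i, ∑ j, A i j * B i j := by
  simp only [trace, diag_apply, mul_apply, transpose_apply]
  exact Finset.sum_comm

/-- The subgradient inequality for the `ℓ₁` norm at `S`, with a gap off the support of `S`. -/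
theorem l1Norm_add_ge {γ κ : ℝ} (hγ : 0 ≤ γ) {S G : Matrix (Fin p) (Fin n) ℝ}
    (hon : ∀ i j, S i j ≠ 0 → G i j = γ * SignType.sign (S i j))
    (hoff : ∀ i j, S i j = 0 → |G i j| ≤ κ) (D : Matrix (Fin p) (Fin n) ℝ) :
    γ * l1Norm S + trace (Gᵀ * D) + (γ - κ) * ∑ i, ∑ j, |D i j - supportProj S D i j| ≤
      γ * l1Norm (S + D) := by
  rw [trace_transpose_mul_eq_sum]
  simp only [l1Norm, Finset.mul_sum, ← Finset.sum_add_distrib]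
  refine Finset.sum_le_sum fun i _ => Finset.sum_le_sum fun j _ => ?_
  rw [supportProj_apply, Matrix.add_apply]
  split_ifs with h
  · have h1 : G i j * D i j ≤ κ * |D i j| :=
      (le_abs_self _).trans ((abs_mul _ _).trans_le
        (mul_le_mul_of_nonneg_right (hoff i j h) (abs_nonneg _)))
    rw [h, abs_zero, mul_zero, zero_add, zero_add, sub_zero]
    linarith
  · rw [hon i j h, sub_self, abs_zero, mul_zero, add_zero, mul_assoc, ← mul_add]
    refine mul_le_mul_of_nonneg_left ?_ hγ
    rcases lt_or_gt_of_ne h with h | h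
    · rw [sign_neg h, abs_of_neg h]
      simp only [SignType.coe_neg, SignType.coe_one]
      linarith [neg_abs_le (S i j + D i j)]
    · rw [sign_pos h, abs_of_pos h]
      simp only [SignType.coe_one]
      linarith [le_abs_self (S i j + D i j)]

variable {W : Matrix (Fin m) (Fin p) ℝ} {S : Matrix (Fin p) (Fin n) ℝ}
  {Y : Matrix (Fin m) (Fin n) ℝ} {δ : ℝ}

theorem exists_forall_isOptimizer_eq (hδ : 0 ≤ δ) (hδ' : δ < 1 / 3)
    (hW : ∀ A ∈ Omega S, maxNorm (A - Wᵀ * W * A) ≤ δ * maxNorm A)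
    (hinc : mu W S * xi W Y < (1 - 3 * δ) / 6) :
    ∃ γ : ℝ, 0 < γ ∧ ∀ S' Y', IsOptimizer γ W (W * S + Y) S' Y' → S' = S := by
  obtain ⟨E, hE⟩ := exists_isPolarFactor Y
  have hc : δ + 2 * (mu W S * xi W Y) < 1 := by linarith
  have hc0 : 0 ≤ δ + 2 * (mu W S * xi W Y) := by
    have := mul_nonneg (mu_nonneg W S) (xi_nonneg W Y)
    positivity
  obtain ⟨γ, hγ, hγt⟩ := exists_tradeoff (mu_nonneg W S) (xi_nonneg W Y) hδ' hδ hinc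
  obtain ⟨A, hA, hA1, hon, hoff⟩ := exists_certificate hE hδ hW hc hγ.le
  obtain ⟨h1, h2⟩ := hγt _ (maxNorm_nonneg A) hA1
  refine ⟨γ, hγ, fun S' Y' hopt => ?_⟩
  set κ := xi W Y + (δ + 2 * (mu W S * xi W Y)) * maxNorm A
  obtain ⟨D, rfl⟩ : ∃ D, S' = S + D := ⟨S' - S, by abel⟩
  obtain rfl : Y' = Y + -(W * D) := by
    have := hopt.1
    rw [Matrix.mul_add] at this
    rw [eq_sub_of_add_eq this]
    abel
  set Z := -(W * D) with hZ
  set G₀ := normalPart E (W * A) with hG₀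
  have hG₀1 : ‖G₀‖ < 1 :=
    ((hE.norm_normalPart_le _).trans (norm_mul_le_mu W hA)).trans_lt h1
  -- The slack in `‖G₀‖ < 1` allows tilting the subgradient by `ε N(Z)`, which adds the gain
  -- `ε‖N(Z)‖_F²`. The `+ 1` keeps the denominator positive.
  set ε := (1 - ‖G₀‖) / (‖normalPart E Z‖ + 1) with hε
  have hε0 : 0 < ε := div_pos (by linarith) (by positivity)
  have hε1 : ε * ‖normalPart E Z‖ ≤ 1 - ‖G₀‖ := by
    have : ε * (‖normalPart E Z‖ + 1) = 1 - ‖G₀‖ := div_mul_cancel₀ _ (by positivity)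
    linarith
  have hnorm : ‖normalPart E (W * A + ε • Z)‖ ≤ 1 := by
    rw [map_add, map_smul]
    refine (norm_add_le _ _).trans ?_
    rw [norm_smul, Real.norm_of_nonneg hε0.le]
    linarith
  have hnuc := hE.nuclearNorm_add_ge hnorm Z
  rw [← normalPart_apply, map_add, map_smul, ← hG₀, ← add_assoc, transpose_add, Matrix.add_mul,
    trace_add, transpose_smul, Matrix.smul_mul, trace_smul,
    trace_normalPart_mul E Z hE.mul_transpose_mul, smul_eq_mul] at hnuc
  have hl1 := l1Norm_add_ge hγ.le hon hoff D
  have hdual : trace ((E + G₀)ᵀ * Z) = - trace ((Wᵀ * (E + G₀))ᵀ * D) := by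
    rw [hZ, Matrix.mul_neg, trace_neg, transpose_mul, transpose_transpose, Matrix.mul_assoc]
  have hmin := hopt.2 S Y (add_comm _ _)
  have hN : 0 ≤ trace ((normalPart E Z)ᵀ * normalPart E Z) := by
    rw [trace_transpose_mul_eq_sum]
    exact Finset.sum_nonneg fun i _ => Finset.sum_nonneg fun j _ => mul_self_nonneg _
  have hO : 0 ≤ ∑ i, ∑ j, |D i j - supportProj S D i j| :=
    Finset.sum_nonneg fun i _ => Finset.sum_nonneg fun j _ => abs_nonneg _
  have hO' := mul_nonneg (sub_pos.2 h2).le hO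
  have hN' := mul_nonneg hε0.le hN
  -- Adding the two subgradient inequalities cancels the linear terms by `hdual`; optimality then
  -- makes the sum of the two nonnegative gains at most zero, so each vanishes.
  have hO0 : ∑ i, ∑ j, |D i j - supportProj S D i j| = 0 := by
    have : (γ - κ) * ∑ i, ∑ j, |D i j - supportProj S D i j| = 0 := by linarith
    exact (mul_eq_zero.1 this).resolve_left (sub_pos.2 h2).ne'
  have hN0 : trace ((normalPart E Z)ᵀ * normalPart E Z) = 0 := by
    have : ε * trace ((normalPart E Z)ᵀ * normalPart E Z) = 0 := by linarith
    exact (mul_eq_zero.1 this).resolve_left hε0.ne'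
  have hD : D ∈ Omega S := by
    have : D = supportProj S D := by
      ext i j
      rw [Finset.sum_eq_zero_iff_of_nonneg
        fun i _ => Finset.sum_nonneg fun j _ => abs_nonneg _] at hO0
      have h3 := hO0 i (Finset.mem_univ i)
      rw [Finset.sum_eq_zero_iff_of_nonneg fun j _ => abs_nonneg _] at h3
      exact sub_eq_zero.1 (abs_eq_zero.1 (h3 j (Finset.mem_univ j)))
    rw [this]
    exact supportProj_mem S D
  have hNZ : normalPart E (W * D) = 0 := by
    rw [← conjTranspose_eq_transpose_of_trivial, trace_conjTranspose_mul_self_eq_zero_iff, hZ,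
      map_neg, neg_eq_zero] at hN0
    exact hN0
  have hD0 : D = 0 := by
    refine eq_zero_of_le_mul_maxNorm hc hc0 fun i j => ?_
    have := abs_sub_transpose_mul_normalPart_le hE hW hD i j
    rwa [hNZ, Matrix.mul_zero, sub_zero] at this
  rw [hD0, add_zero]

/-- `V Vᵀ` projects onto `(ker H)ᗮ`: `H V Vᵀ = H` puts `v - V Vᵀ v` in the kernel, and `V Vᵀ = V Σ⁻¹
Uᵀ H` kills the kernel. -/
theorem projKer_eq_sub {H : Matrix (Fin m) (Fin p) ℝ} {U : Matrix (Fin m) (Fin H.rank) ℝ}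
    {σ : Fin H.rank → ℝ} {V : Matrix (Fin p) (Fin H.rank) ℝ} (h : IsCompactSVD H U σ V)
    (A : Matrix (Fin p) (Fin n) ℝ) : projKer H A = A - V * Vᵀ * A := by
  ext i j
  have hHV : H * (V * Vᵀ) = H := by
    conv_lhs => enter [1]; rw [h.eq_mul]
    rw [Matrix.mul_assoc, ← Matrix.mul_assoc Vᵀ, h.orthonormal_right, Matrix.one_mul, ← h.eq_mul]
  have hVH : V * (diagonal σ⁻¹ * Uᵀ) * H = V * Vᵀ := by
    conv_lhs => enter [2]; rw [h.eq_mul]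
    have h1 : diagonal σ⁻¹ * diagonal σ = 1 := by
      rw [diagonal_mul_diagonal, ← diagonal_one]
      congr 1
      ext i
      exact inv_mul_cancel₀ (h.pos i).ne'
    calc V * (diagonal σ⁻¹ * Uᵀ) * (U * diagonal σ * Vᵀ)
        = V * (diagonal σ⁻¹ * ((Uᵀ * U) * (diagonal σ * Vᵀ))) := by simp only [Matrix.mul_assoc]
      _ = V * ((diagonal σ⁻¹ * diagonal σ) * Vᵀ) := by
          rw [h.orthonormal_left, Matrix.one_mul]; simp only [Matrix.mul_assoc]
      _ = _ := by rw [h1, Matrix.one_mul]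
  set v : Fin p → ℝ := fun k => A k j with hv
  have key : (LinearMap.ker (toEuclideanLin H)).starProjection (WithLp.toLp 2 v) =
      WithLp.toLp 2 (v - (V * Vᵀ) *ᵥ v) := by
    refine Submodule.eq_starProjection_of_mem_of_inner_eq_zero ?_ fun w hw => ?_
    · rw [LinearMap.mem_ker, toLpLin_apply, mulVec_sub, mulVec_mulVec, hHV, sub_self]
      rfl
    · have hw0 : H *ᵥ w.ofLp = 0 := by
        rw [LinearMap.mem_ker, toLpLin_apply] at hw
        exact congrArg WithLp.ofLp hw
      have hw1 : (V * Vᵀ) *ᵥ w.ofLp = 0 := by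
        rw [← hVH, ← mulVec_mulVec, hw0, mulVec_zero]
      rw [← WithLp.toLp_sub, sub_sub_cancel, EuclideanSpace.inner_eq_star_dotProduct]
      have h2 : w.ofLp ⬝ᵥ ((V * Vᵀ) *ᵥ v) = 0 := by
        rw [dotProduct_mulVec, ← mulVec_transpose, transpose_mul, transpose_transpose, hw1,
          zero_dotProduct]
      simpa using h2
  have := congrArg (fun x : EuclideanSpace ℝ (Fin p) => x i) key
  simpa [projKer, mulVec, dotProduct, mul_apply] using this

end Recovery

end MatSep

/-! ### The main theorem. -/

theorem mainTheorem1 {m n p : ℕ}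
    (H : Matrix (Fin m) (Fin p) ℝ)
    (S₀ : Matrix (Fin p) (Fin n) ℝ) (L₀ M₀ : Matrix (Fin m) (Fin n) ℝ)
    (hM₀ : M₀ = H * S₀ + L₀)
    (U : Matrix (Fin m) (Fin H.rank) ℝ) (σ : Fin H.rank → ℝ)
    (V : Matrix (Fin p) (Fin H.rank) ℝ)
    (hsvd : MatSep.IsCompactSVD H U σ V)
    (C : Matrix (Fin m) (Fin m) ℝ)
    (hC : C = U * (Matrix.diagonal σ)⁻¹ * U.transpose)
    (Ht : Matrix (Fin m) (Fin p) ℝ) (hHt : Ht = C * H)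
    (δ : ℝ) (hδ : δ < 1 / 3)
    (hker : ∀ A ∈ MatSep.Omega S₀,
      MatSep.maxNorm (MatSep.projKer H A) ≤ δ * MatSep.maxNorm A)
    (hinc : MatSep.mu Ht S₀ * MatSep.xi Ht (C * L₀) < (1 - 3 * δ) / 6) :
    ∃ γ : ℝ, 0 < γ ∧
      ∀ (S : Matrix (Fin p) (Fin n) ℝ) (Y L : Matrix (Fin m) (Fin n) ℝ),
        MatSep.IsOptimizer γ Ht (C * M₀) S Y → L = M₀ - H * S → S = S₀ ∧ L = L₀ := by
  have hdiag : (Matrix.diagonal σ)⁻¹ * Matrix.diagonal σ = 1 := by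
    refine Matrix.nonsing_inv_mul _ ?_
    rw [Matrix.det_diagonal]
    exact (Finset.prod_ne_zero_iff.2 fun i _ => (hsvd.pos i).ne').isUnit
  have hHtV : Ht = U * V.transpose := by
    rw [hHt, hC]
    conv_lhs => enter [2]; rw [hsvd.eq_mul]
    calc U * (Matrix.diagonal σ)⁻¹ * U.transpose * (U * Matrix.diagonal σ * V.transpose)
        = U * ((Matrix.diagonal σ)⁻¹ *
            ((U.transpose * U) * (Matrix.diagonal σ * V.transpose))) := by
          simp only [Matrix.mul_assoc]
      _ = U * (((Matrix.diagonal σ)⁻¹ * Matrix.diagonal σ) * V.transpose) := by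
          rw [hsvd.orthonormal_left, Matrix.one_mul, Matrix.mul_assoc]
      _ = _ := by rw [hdiag, Matrix.one_mul]
  have hHt2 : Ht.transpose * Ht = V * V.transpose := by
    rw [hHtV, Matrix.transpose_mul, Matrix.transpose_transpose, Matrix.mul_assoc,
      ← Matrix.mul_assoc U.transpose, hsvd.orthonormal_left, Matrix.one_mul]
  -- The certificate needs a nonnegative constant, hence `max δ 0`.
  have hW : ∀ A ∈ MatSep.Omega S₀,
      MatSep.maxNorm (A - Ht.transpose * Ht * A) ≤ max δ 0 * MatSep.maxNorm A := by
    intro A hA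
    rw [hHt2, ← MatSep.projKer_eq_sub hsvd]
    exact (hker A hA).trans
      (mul_le_mul_of_nonneg_right (le_max_left _ _) (MatSep.maxNorm_nonneg A))
  have hinc' : MatSep.mu Ht S₀ * MatSep.xi Ht (C * L₀) < (1 - 3 * max δ 0) / 6 := by
    rcases le_total 0 δ with h | h
    · rwa [max_eq_left h]
    · rcases h.eq_or_lt with rfl | h
      · rwa [max_self]
      -- A negative `δ` leaves only `0` in `Ω(S₀)`, so the product is at most `0` and the bound for
      -- `δ = 0` holds.
      have hmu : MatSep.mu Ht S₀ ≤ 0 := by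
        refine Real.sSup_nonpos ?_
        rintro _ ⟨A, hA, -, rfl⟩
        have h0 : A = 0 := by
          refine MatSep.eq_zero_of_maxNorm_le ?_
          have := (MatSep.maxNorm_nonneg _).trans (hker A hA)
          nlinarith
        simp [h0, MatSep.spectralNorm]
      have := mul_nonpos_of_nonpos_of_nonneg hmu (MatSep.xi_nonneg Ht (C * L₀))
      rw [max_eq_right h.le]
      linarith
  obtain ⟨γ, hγ, hopt⟩ := MatSep.exists_forall_isOptimizer_eq (le_max_right δ 0)
    (max_lt hδ (by norm_num)) hW hinc'
  refine ⟨γ, hγ, fun S Y L hSY hL => ?_⟩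
  have hM : C * M₀ = Ht * S₀ + C * L₀ := by
    rw [hM₀, Matrix.mul_add, ← Matrix.mul_assoc, ← hHt]
  have hS : S = S₀ := hopt S Y (hM ▸ hSY)
  refine ⟨hS, ?_⟩
  rw [hL, hS, hM₀, add_sub_cancel_left]
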